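/- Let $G$ be a group with a finite generating set $X\subseteq G$, let $A = X\cup X^{-1}\subseteq G$ be totally ordered, and let $A^*$ be the set of words over $A$. For $w\in A^*$ write $l(w)$ for its length, $\overline w\in G$ for the element it represents, and $w(i)$ for its prefix of length $i$ (with $w(i)=w$ for $i\ge l(w)$). A word is geodesic if it has minimal length among the words representing the same element. A two-variable automaton reads a pair $(u,v)$ of words as the padded pair $(u,v)^\dagger$ over $A^\dagger=A\cup\{\$\}$, in which the shorter word is extended at its end by the symbol $\$$, representing $1_G$. The word-differences arising from $(u,v)$ are the elements $\overline{u(i)}^{-1}\,\overline{v(i)}$, $i\ge 0$. An automatic structure for $G$ with respect to $X$ consists of finite state automata $W$ over $A$ and $M_x$ over $A^\dagger\times A^\dagger$ for $x\in A\cup\{1_G\}$, such that every element of $G$ is represented by a word in $L(W)$, and $M_x$ accepts exactly the padded pairs $(w_1,w_2)^\dagger$ with $w_1,w_2\in L(W)$ and $\overline{w_1}\,x=\overline{w_2}$. It is short-lex if $L(W)$ is the set of short-lex least representatives of the elements of $G$. The group $G$ is strongly geodesically automatic with respect to $X$ if it has an automatic structure with respect to $X$ for which $L(W)$ is the set of all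 geodesic words. Suppose that a short-lex automatic structure $\{W, M_x\}$ for $G$ with respect to $X$ is given, and consider the following procedure. Let $\mathcal{WD}_1$ be the set of all word-differences arising from the pairs accepted by the multipliers $M_x$, $x\in A\cup\{1_G\}$. For $n\ge 1$, let $WD_n$ be the two-variable automaton with state set $\mathcal{WD}_n$, initial state and only accepting state $1_G$, and a transition $d\to e$ with label $(x,y)$ whenever $d,e\in\mathcal{WD}_n$, $x,y\in A^\dagger$ and $x^{-1}dy=e$ in $G$; let $GE_n$, $GW_n$, $T_n$ be finite state automata with $$L(GE_n)=\{(u,v) : (u,v)\in L(WD_n),\ v\in L(W),\ l(u)=l(v)\},$$ $$L(GW_n)=\{u\in A^* : \exists v\in A^*,\ (u,v)\in L(GE_n)\},$$ $$L(T_n)=\{w\in A^*\setminus L(GW_n) : \exists u,\ (w,u)\in L(WD_n),\ u\in L(GW_n),\ l(u)=l(w)\}.$$ If $L(T_n)$ is empty, the procedure halts. Otherwise choose any word $w\in L(T_n)$, let $v$ be its short-lex least representative, let $\mathcal{WD}_{n+1}$ be the union of $\mathcal{WD}_n$ and the set of word-differences arising from $(w,v)$, and continue with $n+1$ in place of $n$.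 Theorem. This procedure can be carried out: at every stage $\mathcal{WD}_n$ is finite, the languages above are regular (so that the automata exist), and the choices required are possible. Whatever choices are made, the procedure halts (that is, $L(T_n)$ is empty for some $n$) if and only if $G$ is strongly geodesically automatic with respect to $X$. -/

import Mathlib

namespace GeodAut

universe u

variable {G : Type u} [Group G]

/-- The alphabet `A = X ∪ X⁻¹`, as a subset of the group. -/
abbrev Alphabet (X : Set G) : Type u := ↥(X ∪ X⁻¹)

/-- The padded alphabet `A† = A ∪ {$}`; the padding symbol `$` is `none`. -/
abbrev PadAlphabet (X : Set G) : Type u := Option (Alphabet X)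

variable {X : Set G}

/-- The element of `G` represented by a word in `A`. -/
def eval (w : List (Alphabet X)) : G := (w.map Subtype.val).prod

/-- The element of `G` represented by a symbol of `A†`; the symbol `$` maps to the identity. -/
def symVal : PadAlphabet X → G
  | none => 1
  | some a => a.1

/-- The padded pair `(u, v)†`: the shorter word is filled up with `$` at its end. -/
def pad (u v : List (Alphabet X)) : List (PadAlphabet X × PadAlphabet X) :=
  List.zipWithAll Prod.mk u v

/-- The geodesic words: the words of minimal length among those representing the same element. -/
def geodesicWords (X : Set G) : Language (Alphabet X) :=
  {w | ∀ v : List (Alphabet X), eval v = eval w → w.length ≤ v.length}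

/-- The short-lex least representatives of the group elements: lexicographically least among the
shortest words representing the same element. -/
def shortLexWords (X : Set G) [LinearOrder (Alphabet X)] : Language (Alphabet X) :=
  {w | ∀ v : List (Alphabet X), eval v = eval w → w = v ∨ List.Shortlex (· < ·) w v}

/-- The set of word-differences `u(i)⁻¹ v(i)` arising from a pair of words, where `u(i)` is the
prefix of `u` of length `i` (and `u` itself for `i ≥ l(u)`). -/
def wordDiffs (u v : List (Alphabet X)) : Set G :=
  {g | ∃ i : ℕ, g = (eval (u.take i))⁻¹ * eval (v.take i)}

/-- An automatic structure for `G` with respect to `X`: finite state automata `W` (the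
word-acceptor) and `M x` (the multipliers). There is one multiplier for each letter of `A` and one
for the identity element, so that they are indexed by `A ∪ {$}`, with `$` standing for `1`. -/
structure AutomaticStructure (X : Set G) where
  WState : Type
  finite_WState : Finite WState
  W : DFA (Alphabet X) WState
  exists_rep : ∀ g : G, ∃ w ∈ W.accepts, eval w = g
  MState : PadAlphabet X → Type
  finite_MState : ∀ x, Finite (MState x)
  M : ∀ x : PadAlphabet X, DFA (PadAlphabet X × PadAlphabet X) (MState x)
  mem_M : ∀ (x : PadAlphabet X) (p : List (PadAlphabet X × PadAlphabet X)),
    p ∈ (M x).accepts ↔ ∃ w₁ w₂ : List (Alphabet X), p = pad w₁ w₂ ∧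
      w₁ ∈ W.accepts ∧ w₂ ∈ W.accepts ∧ eval w₁ * symVal x = eval w₂

/-- `G` is strongly geodesically automatic with respect to `X`: there is an automatic structure
whose word-acceptor accepts exactly the geodesic words. -/
def StronglyGeodesicallyAutomatic (X : Set G) : Prop :=
  ∃ S : AutomaticStructure X, S.W.accepts = geodesicWords X

/-- The set of all word-differences that arise in the multipliers, that is, from the pairs of
words accepted by some multiplier. -/
def AutomaticStructure.multiplierDiffs (S : AutomaticStructure X) : Set G :=
  {g | ∃ (x : PadAlphabet X) (u v : List (Alphabet X)),
    pad u v ∈ (S.M x).accepts ∧ g ∈ wordDiffs u v}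

/-- The word-difference machine associated with a set `D` of group elements, with the identity
as its initial state and its only accepting state: there is a transition from `d` to `e` with
label `(x, y)` exactly when `x⁻¹ d y = e`. (At most one such `e` exists for given `d, x, y`.)
States that cannot be reached from the initial state do not influence the accepted language. -/
def wdMachine (X : Set G) (D : Set G) : NFA (PadAlphabet X × PadAlphabet X) ↥D where
  step d p := {e | (symVal p.1)⁻¹ * d.1 * symVal p.2 = e.1}
  start := {d | d.1 = 1}
  accept := {d | d.1 = 1}

/-- The language of the geodesic-equality automaton `GE` belonging to the set `D` of
word-differences: the pairs `(u, v)` accepted by the word-difference machine of `D` with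
`v ∈ L(W)` and `l(u) = l(v)`. -/
def AutomaticStructure.langGE (S : AutomaticStructure X) (D : Set G) :
    Language (PadAlphabet X × PadAlphabet X) :=
  {p | ∃ u v : List (Alphabet X), p = pad u v ∧
    pad u v ∈ (wdMachine X D).accepts ∧ v ∈ S.W.accepts ∧ u.length = v.length}

/-- The language of the geodesic word-acceptor `GW` belonging to `D`. -/
def AutomaticStructure.langGW (S : AutomaticStructure X) (D : Set G) : Language (Alphabet X) :=
  {u | ∃ v : List (Alphabet X), pad u v ∈ S.langGE D}

/-- The language of the test automaton `T` belonging to `D`. -/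
def AutomaticStructure.langT (S : AutomaticStructure X) (D : Set G) : Language (Alphabet X) :=
  {w | w ∉ S.langGW D ∧ ∃ u : List (Alphabet X),
    pad w u ∈ (wdMachine X D).accepts ∧ u ∈ S.langGW D ∧ u.length = w.length}

/-- `WD` is the sequence of sets of word-differences produced by a run of the procedure (numbered
from `0`). It starts with the word-differences of the multipliers. As long as the language of the
test automaton is non-empty, some word `w` of that language is selected (any selection is allowed),
`w` is reduced to its short-lex representative `v`, and the word-differences arising from `(w, v)`
are added. When the language of the test automaton is empty, the procedure has halted, and the
sequence is continued by the constant value. -/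
structure AutomaticStructure.IsRun (S : AutomaticStructure X) [LinearOrder (Alphabet X)]
    (WD : ℕ → Set G) : Prop where
  zero : WD 0 = S.multiplierDiffs
  succ : ∀ n, (∃ w, w ∈ S.langT (WD n)) →
    ∃ w ∈ S.langT (WD n), ∃ v ∈ shortLexWords X, eval v = eval w ∧
      WD (n + 1) = WD n ∪ wordDiffs w v
  halted : ∀ n, (¬ ∃ w, w ∈ S.langT (WD n)) → WD (n + 1) = WD n

/-- The run halts: at some stage the language of the test automaton is empty. -/
def AutomaticStructure.Halts (S : AutomaticStructure X) (WD : ℕ → Set G) : Prop :=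
  ∃ n, ∀ w, w ∉ S.langT (WD n)

end GeodAut

/-!
A pair `(u, v)†` is accepted by the word-difference machine of `D` exactly when `u` and `v`
represent the same element and all their word-differences lie in `D`. The word-difference reached
after a prefix of a pair accepted by a multiplier depends only on the state reached, so the
multipliers produce only finitely many word-differences.

Suppose that `D` is finite, contains all multiplier word-differences, and has an empty test
language. If `v` is a short-lex word and `v a` is geodesic, then the multiplier of `a` compares
`v a` with its short-lex representative, so `v a ∈ L(GW)`. If `w ∈ L(GW)` is compared with the
short-lex word `v` and `w a` is geodesic, then `w a` is compared with `v a` by means of `D`, and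
the emptiness of the test language gives `w a ∈ L(GW)`. Hence all geodesic words lie in `L(GW)`.
Passing from geodesic words to their short-lex representatives and back, the word-differences of
geodesic pairs at distance at most one lie in the finite set `D · D · D⁻¹`, so the word-difference
machine of that set provides multipliers for the geodesic words.

Conversely, each round adds a new word-difference of a pair of geodesic words representing the same
element. In a strongly geodesically automatic group these word-differences arise from the
multiplier of the identity in the geodesic structure, so there are only finitely many.
-/

namespace GeodAut

open scoped Pointwise

section Regular

variable {α β : Type*}

theorem isRegular_accepts_dfa {σ : Type*} [Finite σ] (M : DFA α σ) : M.accepts.IsRegular :=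
  have := Fintype.ofFinite σ
  Language.isRegular_iff.2 ⟨σ, this, M, rfl⟩

theorem isRegular_accepts_nfa {σ : Type*} [Finite σ] (M : NFA α σ) : M.accepts.IsRegular :=
  M.toDFA_correct ▸ isRegular_accepts_dfa M.toDFA

theorem isRegular_of_leftQuotient_factorsThrough {σ : Type*} [Finite σ] {L : Language α}
    {f : List α → σ} (h : L.leftQuotient.FactorsThrough f) : L.IsRegular := by
  refine .of_finite_range_leftQuotient
    ((Set.finite_range (Function.extend f L.leftQuotient fun _ => ⊥)).subset ?_)
  rintro _ ⟨x, rfl⟩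
  exact ⟨f x, h.extend_apply _ x⟩

theorem isRegular_filterMap_mem {L : Language β} (hL : L.IsRegular) (f : α → Option β) :
    Language.IsRegular ({x | x.filterMap f ∈ L} : Language α) := by
  refine .of_finite_range_leftQuotient ((hL.finite_range_leftQuotient.image
    fun K => {x | x.filterMap f ∈ K}).subset ?_)
  rintro _ ⟨x, rfl⟩
  refine ⟨_, ⟨x.filterMap f, rfl⟩, Set.ext fun y => ?_⟩
  change x.filterMap f ++ y.filterMap f ∈ L ↔ (x ++ y).filterMap f ∈ L
  rw [List.filterMap_append]

theorem isRegular_map_mem {L : Language β} (hL : L.IsRegular) (f : α → β) :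
    Language.IsRegular ({x | x.map f ∈ L} : Language α) := by
  simpa only [List.filterMap_eq_map] using isRegular_filterMap_mem hL (some ∘ f)

theorem isRegular_append_mem {L : Language α} (hL : L.IsRegular) (y : List α) :
    Language.IsRegular ({x | x ++ y ∈ L} : Language α) := by
  refine .of_finite_range_leftQuotient ((hL.finite_range_leftQuotient.image
    fun K => {x | x ++ y ∈ K}).subset ?_)
  rintro _ ⟨x, rfl⟩
  refine ⟨_, ⟨x, rfl⟩, Set.ext fun z => ?_⟩
  change x ++ (z ++ y) ∈ L ↔ (x ++ z) ++ y ∈ L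
  rw [List.append_assoc]

theorem isRegular_notMem (a : α) : Language.IsRegular ({x | a ∉ x} : Language α) :=
  isRegular_of_leftQuotient_factorsThrough (f := fun x => a ∈ x)
    fun x y (hxy : (a ∈ x) = (a ∈ y)) => Set.ext fun z => by
      change a ∉ x ++ z ↔ a ∉ y ++ z
      rw [List.mem_append, List.mem_append, hxy]

theorem isRegular_pairwise_imp (P : α → Prop) :
    Language.IsRegular ({x | x.Pairwise fun a b => P a → P b} : Language α) := by
  refine isRegular_of_leftQuotient_factorsThrough
    (f := fun x => (x.Pairwise fun a b => P a → P b, ∃ a ∈ x, P a))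
    fun x y hxy => Set.ext fun z => ?_
  obtain ⟨hpairwise, hexists⟩ := Prod.mk.inj hxy
  change (x ++ z).Pairwise (fun a b => P a → P b) ↔ (y ++ z).Pairwise fun a b => P a → P b
  have hcross (w : List α) :
      (∀ a ∈ w, ∀ b ∈ z, P a → P b) ↔ ((∃ a ∈ w, P a) → ∀ b ∈ z, P b) :=
    ⟨fun h ⟨a, ha, hPa⟩ b hb => h a ha b hb hPa, fun h a ha b hb hPa => h ⟨a, ha, hPa⟩ b hb⟩
  rw [List.pairwise_append, List.pairwise_append, hcross, hcross, hpairwise, hexists]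

theorem isRegular_map {L : Language α} (hL : L.IsRegular) (f : α → β) :
    (Language.map f L).IsRegular := by
  -- A left quotient of the image is a union of images of left quotients of `L`.
  refine .of_finite_range_leftQuotient ((hL.finite_range_leftQuotient.finite_subsets.image
    fun 𝒦 => {z | ∃ K ∈ 𝒦, z ∈ Language.map f K}).subset ?_)
  rintro _ ⟨y, rfl⟩
  refine ⟨L.leftQuotient '' {x | x.map f = y}, Set.image_subset_range .., Set.ext fun z => ?_⟩
  constructor
  · rintro ⟨_, ⟨x, rfl, rfl⟩, w, hw, rfl⟩
    exact ⟨x ++ w, hw, List.map_append⟩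
  · rintro ⟨x, hx, hxyz⟩
    obtain ⟨x₁, x₂, rfl, rfl, rfl⟩ := List.map_eq_append_iff.1 hxyz
    exact ⟨_, ⟨x₁, rfl, rfl⟩, x₂, hx, rfl⟩

end Regular

universe u

variable {G : Type u} [Group G] {X : Set G}

section Pad

variable {u v u' v' : List (Alphabet X)} {p : List (PadAlphabet X × PadAlphabet X)}

@[simp] theorem pad_nil_left (v : List (Alphabet X)) : pad [] v = v.map fun b => (none, some b) :=
  List.nil_zipWithAll

@[simp] theorem pad_nil_right (u : List (Alphabet X)) : pad u [] = u.map fun a => (some a, none) :=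
  List.zipWithAll_nil

@[simp] theorem pad_cons_cons (a b : Alphabet X) (u v : List (Alphabet X)) :
    pad (a :: u) (b :: v) = (some a, some b) :: pad u v :=
  List.zipWithAll_cons_cons

@[simp] theorem filterMap_fst_pad (u v : List (Alphabet X)) :
    (pad u v).filterMap Prod.fst = u := by
  induction u generalizing v with
  | nil => simp
  | cons a u ih => cases v <;> simp [ih]

@[simp] theorem filterMap_snd_pad (u v : List (Alphabet X)) :
    (pad u v).filterMap Prod.snd = v := by
  induction u generalizing v with
  | nil => simp
  | cons a u ih => cases v <;> simp [ih]

theorem pad_inj (h : pad u v = pad u' v') : u = u' ∧ v = v' :=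
  ⟨by rw [← filterMap_fst_pad u v, h, filterMap_fst_pad],
    by rw [← filterMap_snd_pad u v, h, filterMap_snd_pad]⟩

theorem take_pad (u v : List (Alphabet X)) (i : ℕ) :
    (pad u v).take i = pad (u.take i) (v.take i) := by
  induction i generalizing u v with
  | zero => simp
  | succ i ih => cases u <;> cases v <;> simp [ih]

theorem pad_append (h : u.length = v.length) (u' v' : List (Alphabet X)) :
    pad (u ++ u') (v ++ v') = pad u v ++ pad u' v' := by
  induction u generalizing v with
  | nil => simp [List.length_eq_zero_iff.1 h.symm]
  | cons a u ih =>
    cases v with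
    | nil => simp at h
    | cons b v => simp [ih (by simpa using h)]

theorem pad_eq_map_zip (h : u.length = v.length) :
    pad u v = (u.zip v).map (Prod.map some some) := by
  induction u generalizing v with
  | nil => simp [List.length_eq_zero_iff.1 h.symm]
  | cons a u ih =>
    cases v with
    | nil => simp at h
    | cons b v => simp [ih (by simpa using h)]

theorem exists_pad_eq_iff : (∃ u v : List (Alphabet X), pad u v = p) ↔ (none, none) ∉ p ∧
    p.Pairwise fun c d => (c.1 = none → d.1 = none) ∧ (c.2 = none → d.2 = none) := by
  constructor
  · rintro ⟨u, v, rfl⟩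
    induction u generalizing v with
    | nil => simp [List.pairwise_map, List.pairwise_of_forall]
    | cons a u ih => cases v <;> simp_all [List.pairwise_map, List.pairwise_of_forall]
  · rintro ⟨hmem, hp⟩
    induction p with
    | nil => exact ⟨[], [], rfl⟩
    | cons c p ih =>
      rw [List.pairwise_cons] at hp
      rw [List.mem_cons, not_or] at hmem
      obtain ⟨u, v, rfl⟩ := ih hmem.2 hp.2
      obtain ⟨hc, -⟩ := hp
      match c with
      | (none, none) => simp at hmem
      | (some a, some b) => exact ⟨a :: u, b :: v, pad_cons_cons a b u v⟩
      | (some a, none) =>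
        have hv : v = [] := by
          rw [← filterMap_snd_pad u v, List.filterMap_eq_nil_iff]
          exact fun d hd => (hc d hd).2 rfl
        exact ⟨a :: u, [], by simp [hv]⟩
      | (none, some b) =>
        have hu : u = [] := by
          rw [← filterMap_fst_pad u v, List.filterMap_eq_nil_iff]
          exact fun d hd => (hc d hd).1 rfl
        exact ⟨[], b :: v, by simp [hu]⟩

theorem isRegular_exists_pad_eq : Language.IsRegular
    ({p | ∃ u v : List (Alphabet X), pad u v = p} : Language (PadAlphabet X × PadAlphabet X)) := by
  simp only [exists_pad_eq_iff, List.pairwise_and_iff]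
  exact (isRegular_notMem _).inf ((isRegular_pairwise_imp _).inf (isRegular_pairwise_imp _))

theorem isRegular_image2_pad {L L' : Language (Alphabet X)} (hL : L.IsRegular)
    (hL' : L'.IsRegular) :
    Language.IsRegular (Set.image2 pad L L' : Language (PadAlphabet X × PadAlphabet X)) := by
  have heq : (Set.image2 pad L L' : Language _) = {p | ∃ u v, pad u v = p} ⊓
      ({p | p.filterMap Prod.fst ∈ L} ⊓ {p | p.filterMap Prod.snd ∈ L'}) := by
    ext p
    constructor
    · rintro ⟨u, hu, v, hv, rfl⟩
      rw [← filterMap_fst_pad u v] at hu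
      nth_rw 1 [← filterMap_snd_pad u v] at hv
      exact ⟨⟨u, v, rfl⟩, hu, hv⟩
    · rintro ⟨⟨u, v, rfl⟩, hu, hv⟩
      replace hu : (pad u v).filterMap Prod.fst ∈ L := hu
      replace hv : (pad u v).filterMap Prod.snd ∈ L' := hv
      rw [filterMap_fst_pad] at hu
      rw [filterMap_snd_pad] at hv
      exact ⟨u, hu, v, hv, rfl⟩
  exact heq ▸ isRegular_exists_pad_eq.inf
    ((isRegular_filterMap_mem hL Prod.fst).inf (isRegular_filterMap_mem hL' Prod.snd))

end Pad

section WordDifferences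

@[simp] theorem eval_append (u v : List (Alphabet X)) : eval (u ++ v) = eval u * eval v := by
  simp [eval]

theorem eval_toList (x : PadAlphabet X) : eval x.toList = symVal x := by
  cases x <;> simp [eval, symVal]

@[simp] theorem eval_singleton (a : Alphabet X) : eval [a] = symVal (some a) :=
  eval_toList (some a)

/-- The group element by which the two components of a word over pairs of padded letters differ;
the symbol `$` represents `1`, so it is dropped from both components. For a word of the form
`pad u v` this is the last of the word-differences arising from `(u, v)`. -/
def diff (p : List (PadAlphabet X × PadAlphabet X)) : G :=
  (eval (p.filterMap Prod.fst))⁻¹ * eval (p.filterMap Prod.snd)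

@[simp] theorem diff_nil : diff ([] : List (PadAlphabet X × PadAlphabet X)) = 1 := by simp [diff]

@[simp] theorem diff_pad (u v : List (Alphabet X)) : diff (pad u v) = (eval u)⁻¹ * eval v := by
  simp [diff]

theorem diff_append (p q : List (PadAlphabet X × PadAlphabet X)) : diff (p ++ q) =
    (eval (q.filterMap Prod.fst))⁻¹ * diff p * eval (q.filterMap Prod.snd) := by
  simp [diff, mul_assoc]

theorem diff_concat (p : List (PadAlphabet X × PadAlphabet X)) (c : PadAlphabet X × PadAlphabet X) :
    diff (p ++ [c]) = (symVal c.1)⁻¹ * diff p * symVal c.2 := by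
  rw [diff_append, ← eval_toList, ← eval_toList]
  obtain ⟨_ | _, _ | _⟩ := c <;> rfl

theorem wordDiffs_eq_image_diff (u v : List (Alphabet X)) :
    wordDiffs u v = diff '' {q | q <+: pad u v} := by
  ext g
  constructor
  · rintro ⟨i, rfl⟩
    exact ⟨(pad u v).take i, List.take_prefix .., by rw [take_pad, diff_pad]⟩
  · rintro ⟨q, hq, rfl⟩
    exact ⟨q.length, by rw [List.prefix_iff_eq_take.1 hq, take_pad, diff_pad, ← take_pad,
      ← List.prefix_iff_eq_take.1 hq]⟩

theorem wordDiffs_subset_iff {u v : List (Alphabet X)} {D : Set G} :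
    wordDiffs u v ⊆ D ↔ ∀ q, q <+: pad u v → diff q ∈ D := by
  rw [wordDiffs_eq_image_diff, Set.image_subset_iff]
  rfl

theorem wordDiffs_finite (u v : List (Alphabet X)) : (wordDiffs u v).Finite := by
  rw [wordDiffs_eq_image_diff]
  refine Set.Finite.image _ ((pad u v).inits.finite_toSet.subset fun q hq => ?_)
  exact (List.mem_inits _ _).2 hq

theorem one_mem_wordDiffs (u v : List (Alphabet X)) : (1 : G) ∈ wordDiffs u v := ⟨0, by simp⟩

theorem wordDiffs_inv (u v : List (Alphabet X)) : (wordDiffs u v)⁻¹ = wordDiffs v u := by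
  ext g
  simp [wordDiffs, inv_eq_iff_eq_inv]

theorem wordDiffs_subset_mul (u v w : List (Alphabet X)) :
    wordDiffs u w ⊆ wordDiffs u v * wordDiffs v w := by
  rintro _ ⟨i, rfl⟩
  exact ⟨_, ⟨i, rfl⟩, _, ⟨i, rfl⟩, by group⟩

theorem wordDiffs_subset_append {u v : List (Alphabet X)} (h : u.length = v.length)
    (u' v' : List (Alphabet X)) : wordDiffs u v ⊆ wordDiffs (u ++ u') (v ++ v') :=
  wordDiffs_subset_iff.2 fun q hq => wordDiffs_eq_image_diff (u ++ u') (v ++ v') ▸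
    ⟨q, pad_append h u' v' ▸ hq.trans (List.prefix_append _ _), rfl⟩

theorem wordDiffs_concat {u v : List (Alphabet X)} (h : u.length = v.length) (a b : Alphabet X) :
    wordDiffs (u ++ [a]) (v ++ [b]) =
      insert ((eval (u ++ [a]))⁻¹ * eval (v ++ [b])) (wordDiffs u v) := by
  have hpad : pad (u ++ [a]) (v ++ [b]) = pad u v ++ [(some a, some b)] := by simp [pad_append h]
  rw [← diff_pad, wordDiffs_eq_image_diff, wordDiffs_eq_image_diff, ← Set.image_insert_eq, hpad]
  simp only [List.prefix_concat_iff]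
  rfl

theorem finite_image_diff_prefixes {L : Language (PadAlphabet X × PadAlphabet X)}
    (hL : L.IsRegular) {g : G} (hg : ∀ p ∈ L, diff p = g) :
    (diff '' {q | ∃ p ∈ L, q <+: p}).Finite := by
  -- `diff q` is determined by `g` and any `r` with `q ++ r ∈ L`, hence by the left quotient at `q`.
  have hdiff : ∀ q, (∃ p ∈ L, q <+: p) → ∀ q', L.leftQuotient q = L.leftQuotient q' →
      diff q = diff q' := by
    rintro q ⟨_, hqr, r, rfl⟩ q' hq
    have hqr' : q' ++ r ∈ L := (Set.ext_iff.1 hq r).1 hqr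
    have heq := (hg _ hqr).trans (hg _ hqr').symm
    simpa only [diff_append, mul_left_inj, mul_right_inj] using heq
  choose! q hq hdq using fun d (hd : d ∈ diff '' {q | ∃ p ∈ L, q <+: p}) => hd
  refine .of_injOn (f := fun d => L.leftQuotient (q d)) (fun d _ => Set.mem_range_self (q d))
    (fun d hd d' hd' h => ?_) hL.finite_range_leftQuotient
  rw [← hdq d hd, ← hdq d' hd']
  exact hdiff _ (hq d hd) _ h

end WordDifferences

section WordDifferenceMachine

variable {D : Set G} {u v : List (Alphabet X)} {p : List (PadAlphabet X × PadAlphabet X)}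

theorem mem_eval_wdMachine {e : ↥D} : e ∈ (wdMachine X D).eval p ↔
    e.1 = diff p ∧ ∀ q, q <+: p → diff q ∈ D := by
  induction p using List.reverseRecOn generalizing e with
  | nil =>
    have hstart : e ∈ (wdMachine X D).eval [] ↔ e.1 = 1 := Iff.rfl
    simp only [hstart, List.prefix_nil, forall_eq, diff_nil]
    exact ⟨fun he => ⟨he, he ▸ e.2⟩, And.left⟩
  | append_singleton p c ih =>
    have hstep (d e : ↥D) : e ∈ (wdMachine X D).step d c ↔
      (symVal c.1)⁻¹ * d.1 * symVal c.2 = e.1 := Iff.rfl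
    simp only [NFA.eval_append_singleton, NFA.mem_stepSet, ih, hstep, List.prefix_concat_iff,
      forall_eq_or_imp, diff_concat]
    constructor
    · rintro ⟨d, ⟨hd, hp⟩, he⟩
      rw [← hd, he]
      exact ⟨rfl, e.2, hp⟩
    · rintro ⟨he, -, hp⟩
      exact ⟨⟨diff p, hp p List.prefix_rfl⟩, ⟨rfl, hp⟩, he.symm⟩

theorem mem_accepts_wdMachine :
    p ∈ (wdMachine X D).accepts ↔ diff p = 1 ∧ ∀ q, q <+: p → diff q ∈ D := by
  constructor
  · rintro ⟨e, he, hp⟩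
    rw [mem_eval_wdMachine] at hp
    exact ⟨hp.1.symm.trans he, hp.2⟩
  · rintro ⟨hp, hD⟩
    exact ⟨⟨diff p, hD p List.prefix_rfl⟩, hp, mem_eval_wdMachine.2 ⟨rfl, hD⟩⟩

theorem pad_mem_accepts_wdMachine :
    pad u v ∈ (wdMachine X D).accepts ↔ eval u = eval v ∧ wordDiffs u v ⊆ D := by
  rw [mem_accepts_wdMachine, ← wordDiffs_subset_iff, diff_pad, inv_mul_eq_one]

/-- Reading the letter `(x, $)` after `(u, v)†` turns the word-difference `d` into `x⁻¹ d`. -/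
theorem pad_append_mem_accepts_wdMachine (h1 : 1 ∈ D) (x : PadAlphabet X) :
    pad u v ++ [(x, none)] ∈ (wdMachine X D).accepts ↔
      eval u * symVal x = eval v ∧ wordDiffs u v ⊆ D := by
  have hdiff : diff (pad u v ++ [(x, none)]) = 1 ↔ eval u * symVal x = eval v := by
    rw [diff_concat, diff_pad, symVal, mul_one, inv_mul_eq_one, eq_inv_mul_iff_mul_eq]
  simp only [mem_accepts_wdMachine, List.prefix_concat_iff, forall_eq_or_imp, hdiff,
    wordDiffs_subset_iff]
  exact and_congr_right fun h => and_iff_right (hdiff.2 h ▸ h1)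

end WordDifferenceMachine

section SynchronousPairs

variable {D : Set G} {L : Language (Alphabet X)}

theorem isRegular_accepts_wdMachine (hD : D.Finite) : (wdMachine X D).accepts.IsRegular :=
  have := hD.to_subtype
  isRegular_accepts_nfa _

/-- The pairs of words `(u, v)` of equal length with `v ∈ L` that the word-difference machine of
`D` accepts. A pair of words of equal length is encoded as a single word over pairs of letters, so
that projections of the set of such pairs become images of a language under letter maps. -/
def synchronousPairs (D : Set G) (L : Language (Alphabet X)) :
    Language (Alphabet X × Alphabet X) :=
  {z | z.map (Prod.map some some) ∈ (wdMachine X D).accepts ∧ z.map Prod.snd ∈ L}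

theorem isRegular_synchronousPairs (hD : D.Finite) (hL : L.IsRegular) :
    (synchronousPairs D L).IsRegular :=
  (isRegular_map_mem (isRegular_accepts_wdMachine hD) _).inf (isRegular_map_mem hL _)

theorem zip_mem_synchronousPairs {u v : List (Alphabet X)} (hlen : u.length = v.length) :
    u.zip v ∈ synchronousPairs D L ↔ pad u v ∈ (wdMachine X D).accepts ∧ v ∈ L := by
  have hsnd : (u.zip v).map Prod.snd = v := List.map_snd_zip hlen.ge
  change (u.zip v).map (Prod.map some some) ∈ _ ∧ (u.zip v).map Prod.snd ∈ L ↔ _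
  rw [← pad_eq_map_zip hlen, hsnd]

theorem mem_map_synchronousPairs {β : Type*} {f : Alphabet X × Alphabet X → β} {y : List β} :
    y ∈ Language.map f (synchronousPairs D L) ↔ ∃ u v, u.length = v.length ∧
      (pad u v ∈ (wdMachine X D).accepts ∧ v ∈ L) ∧ (u.zip v).map f = y := by
  constructor
  · rintro ⟨z, hz, rfl⟩
    have hlen : (z.map Prod.fst).length = (z.map Prod.snd).length := by simp
    have hzip : (z.map Prod.fst).zip (z.map Prod.snd) = z := (List.zip_of_prod rfl rfl).symm
    exact ⟨_, _, hlen, (zip_mem_synchronousPairs hlen).1 (hzip.symm ▸ hz), hzip.symm ▸ rfl⟩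
  · rintro ⟨u, v, hlen, huv, rfl⟩
    exact ⟨u.zip v, (zip_mem_synchronousPairs hlen).2 huv, rfl⟩

theorem mem_map_fst_synchronousPairs {u : List (Alphabet X)} :
    u ∈ Language.map Prod.fst (synchronousPairs D L) ↔
      ∃ v ∈ L, u.length = v.length ∧ eval u = eval v ∧ wordDiffs u v ⊆ D := by
  simp only [mem_map_synchronousPairs, pad_mem_accepts_wdMachine]
  constructor
  · rintro ⟨u, v, hlen, ⟨huv, hv⟩, rfl⟩
    rw [List.map_fst_zip hlen.le]
    exact ⟨v, hv, hlen, huv⟩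
  · rintro ⟨v, hv, hlen, huv⟩
    exact ⟨u, v, hlen, ⟨huv, hv⟩, List.map_fst_zip hlen.le⟩

end SynchronousPairs

section Geodesic

variable {u v : List (Alphabet X)}

theorem mem_geodesicWords_of_eq (hv : v ∈ geodesicWords X) (hlen : u.length = v.length)
    (heval : eval u = eval v) : u ∈ geodesicWords X :=
  fun w hw => hlen ▸ hv w (hw.trans heval)

theorem length_eq_of_mem_geodesicWords (hu : u ∈ geodesicWords X) (hv : v ∈ geodesicWords X)
    (heval : eval u = eval v) : u.length = v.length :=
  le_antisymm (hu v heval.symm) (hv u heval)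

theorem mem_geodesicWords_of_append (h : u ++ v ∈ geodesicWords X) : u ∈ geodesicWords X :=
  fun w hw => by simpa using h (w ++ v) (by simp [hw])

theorem shortLexWords_le_geodesicWords [LinearOrder (Alphabet X)] :
    shortLexWords X ≤ geodesicWords X := by
  intro w hw v hv
  rcases hw v hv with rfl | hwv
  · exact le_rfl
  · rcases List.shortlex_def.1 hwv with hlt | ⟨heq, -⟩
    · exact hlt.le
    · exact heq.le

end Geodesic

theorem exists_automaticStructure_of_wordDiffs_subset {L : Language (Alphabet X)} (hL : L.IsRegular)
    (hrep : ∀ g : G, ∃ w ∈ L, eval w = g) {E : Set G} (hE : E.Finite)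
    (hsub : ∀ u ∈ L, ∀ v ∈ L, ∀ x : PadAlphabet X,
      eval u * symVal x = eval v → wordDiffs u v ⊆ E) :
    ∃ S : AutomaticStructure X, S.W.accepts = L := by
  have h1 : 1 ∈ E := by
    obtain ⟨w, hw, -⟩ := hrep 1
    exact hsub w hw w hw none (by simp [symVal]) (one_mem_wordDiffs w w)
  have hM (x : PadAlphabet X) : Language.IsRegular (Set.image2 pad L L ⊓
      {p | p ++ [(x, none)] ∈ (wdMachine X E).accepts} : Language _) :=
    (isRegular_image2_pad hL hL).inf (isRegular_append_mem (isRegular_accepts_wdMachine hE) _)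
  obtain ⟨σ, _, W, rfl⟩ := hL
  choose τ hτ M hM using hM
  refine ⟨⟨σ, inferInstance, W, hrep, τ, fun x => @Finite.of_fintype _ (hτ x), M, ?_⟩, rfl⟩
  intro x p
  rw [hM]
  constructor
  · rintro ⟨⟨u, hu, v, hv, rfl⟩, huv⟩
    exact ⟨u, v, rfl, hu, hv, ((pad_append_mem_accepts_wdMachine h1 x).1 huv).1⟩
  · rintro ⟨u, v, rfl, hu, hv, huv⟩
    exact ⟨⟨u, hu, v, hv, rfl⟩,
      (pad_append_mem_accepts_wdMachine h1 x).2 ⟨huv, hsub u hu v hv x huv⟩⟩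

namespace AutomaticStructure

variable (S : AutomaticStructure X) {D : Set G} {u v w : List (Alphabet X)}

theorem isRegular_accepts_W : S.W.accepts.IsRegular :=
  have := S.finite_WState
  isRegular_accepts_dfa S.W

theorem multiplierDiffs_finite (hX : X.Finite) : S.multiplierDiffs.Finite := by
  have : Finite (Alphabet X) := (hX.union hX.inv).to_subtype
  have hfinite (x : PadAlphabet X) : (diff '' {q | ∃ p ∈ (S.M x).accepts, q <+: p}).Finite := by
    have := S.finite_MState x
    refine finite_image_diff_prefixes (isRegular_accepts_dfa (S.M x)) (g := symVal x) fun p hp => ?_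
    obtain ⟨u, v, rfl, -, -, huv⟩ := (S.mem_M x p).1 hp
    rw [diff_pad, ← huv, inv_mul_cancel_left]
  refine (Set.finite_iUnion hfinite).subset ?_
  rintro g ⟨x, u, v, huv, hg⟩
  rw [wordDiffs_eq_image_diff] at hg
  obtain ⟨q, hq, rfl⟩ := hg
  exact Set.mem_iUnion.2 ⟨x, q, ⟨_, huv, hq⟩, rfl⟩

variable {S}

theorem wordDiffs_subset_multiplierDiffs (hu : u ∈ S.W.accepts) (hv : v ∈ S.W.accepts)
    {x : PadAlphabet X} (huv : eval u * symVal x = eval v) :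
    wordDiffs u v ⊆ S.multiplierDiffs :=
  fun _ hg => ⟨x, u, v, (S.mem_M x _).2 ⟨u, v, rfl, hu, hv, huv⟩, hg⟩

theorem wordDiffs_subset_multiplierDiffs_of_eq (hu : u ∈ S.W.accepts) (hv : v ∈ S.W.accepts)
    (huv : eval u = eval v) : wordDiffs u v ⊆ S.multiplierDiffs :=
  wordDiffs_subset_multiplierDiffs hu hv (x := none) ((mul_one _).trans huv)

theorem one_mem_multiplierDiffs : 1 ∈ S.multiplierDiffs := by
  obtain ⟨w, hw, -⟩ := S.exists_rep 1
  exact wordDiffs_subset_multiplierDiffs_of_eq hw hw rfl (one_mem_wordDiffs w w)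

theorem mem_langGW : u ∈ S.langGW D ↔ ∃ v ∈ S.W.accepts, u.length = v.length ∧
    eval u = eval v ∧ wordDiffs u v ⊆ D := by
  simp only [← pad_mem_accepts_wdMachine]
  constructor
  · rintro ⟨v, u', v', hpad, huv, hv, hlen⟩
    obtain ⟨rfl, rfl⟩ := pad_inj hpad
    exact ⟨v, hv, hlen, huv⟩
  · rintro ⟨v, hv, hlen, huv⟩
    exact ⟨v, u, v, rfl, huv, hv, hlen⟩

theorem mem_langT : w ∈ S.langT D ↔ w ∉ S.langGW D ∧ ∃ u ∈ S.langGW D,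
    w.length = u.length ∧ eval w = eval u ∧ wordDiffs w u ⊆ D := by
  simp only [← pad_mem_accepts_wdMachine]
  exact and_congr_right fun _ => exists_congr fun u =>
    ⟨fun ⟨hwu, hu, hlen⟩ => ⟨hu, hlen.symm, hwu⟩, fun ⟨hu, hlen, hwu⟩ => ⟨hwu, hu, hlen.symm⟩⟩

variable (S)

theorem langGE_eq_map :
    S.langGE D = Language.map (Prod.map some some) (synchronousPairs D S.W.accepts) := by
  ext p
  rw [mem_map_synchronousPairs]
  refine exists₂_congr fun u v => ⟨?_, ?_⟩
  · rintro ⟨rfl, huv, hv, hlen⟩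
    exact ⟨hlen, ⟨huv, hv⟩, (pad_eq_map_zip hlen).symm⟩
  · rintro ⟨hlen, ⟨huv, hv⟩, rfl⟩
    exact ⟨(pad_eq_map_zip hlen).symm, huv, hv, hlen⟩

theorem langGW_eq_map :
    S.langGW D = Language.map Prod.fst (synchronousPairs D S.W.accepts) :=
  Set.ext fun _ => mem_langGW.trans mem_map_fst_synchronousPairs.symm

theorem langT_eq_compl_inf_map :
    S.langT D = (S.langGW D)ᶜ ⊓ Language.map Prod.fst (synchronousPairs D (S.langGW D)) :=
  Set.ext fun _ => mem_langT.trans (and_congr_right fun _ => mem_map_fst_synchronousPairs.symm)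

theorem isRegular_langGE (hD : D.Finite) : (S.langGE D).IsRegular :=
  S.langGE_eq_map ▸ isRegular_map (isRegular_synchronousPairs hD S.isRegular_accepts_W) _

theorem isRegular_langGW (hD : D.Finite) : (S.langGW D).IsRegular :=
  S.langGW_eq_map ▸ isRegular_map (isRegular_synchronousPairs hD S.isRegular_accepts_W) _

theorem isRegular_langT (hD : D.Finite) : (S.langT D).IsRegular :=
  S.langT_eq_compl_inf_map ▸ (S.isRegular_langGW hD).compl.inf
    (isRegular_map (isRegular_synchronousPairs hD (S.isRegular_langGW hD)) _)

variable {S}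

theorem langGW_le_geodesicWords (hS : S.W.accepts ≤ geodesicWords X) :
    S.langGW D ≤ geodesicWords X := by
  intro u hu
  obtain ⟨v, hv, hlen, heval, -⟩ := mem_langGW.1 hu
  exact mem_geodesicWords_of_eq (hS hv) hlen heval

theorem langT_le_geodesicWords (hS : S.W.accepts ≤ geodesicWords X) :
    S.langT D ≤ geodesicWords X := by
  intro w hw
  obtain ⟨-, u, hu, hlen, heval, -⟩ := mem_langT.1 hw
  exact mem_geodesicWords_of_eq (langGW_le_geodesicWords hS hu) hlen heval

theorem nil_mem_langGW (hS : S.W.accepts ≤ geodesicWords X) (hD : 1 ∈ D) : [] ∈ S.langGW D := by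
  obtain ⟨v, hv, heval⟩ := S.exists_rep 1
  have hnil : v = [] := List.length_eq_zero_iff.1 (Nat.le_zero.1 (hS hv [] heval.symm))
  refine mem_langGW.2 ⟨[], hnil ▸ hv, rfl, rfl, ?_⟩
  rintro _ ⟨i, rfl⟩
  simpa using hD

theorem concat_mem_langGW (hS : S.W.accepts ≤ geodesicWords X) (hD : S.multiplierDiffs ⊆ D)
    {a : Alphabet X} (hv : v ∈ S.W.accepts) (hva : v ++ [a] ∈ geodesicWords X) :
    v ++ [a] ∈ S.langGW D := by
  obtain ⟨w, hw, heval⟩ := S.exists_rep (eval (v ++ [a]))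
  have hlen := length_eq_of_mem_geodesicWords hva (hS hw) heval.symm
  obtain ⟨w, b, rfl⟩ : ∃ w' b, w = w' ++ [b] :=
    ⟨_, _, (List.dropLast_append_getLast fun h => by simp [h] at hlen).symm⟩
  have hlen' : v.length = w.length := by simpa using hlen
  refine mem_langGW.2 ⟨_, hw, hlen, heval.symm, ?_⟩
  rw [wordDiffs_concat hlen', heval, inv_mul_cancel]
  refine Set.insert_subset (hD one_mem_multiplierDiffs) ?_
  calc wordDiffs v w ⊆ wordDiffs (v ++ []) (w ++ [b]) := wordDiffs_subset_append hlen' ..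
    _ = wordDiffs v (w ++ [b]) := by rw [List.append_nil]
    _ ⊆ S.multiplierDiffs := wordDiffs_subset_multiplierDiffs hv hw (x := some a)
        (by rw [heval, eval_append, eval_singleton])
    _ ⊆ D := hD

theorem langGW_eq_geodesicWords (hS : S.W.accepts ≤ geodesicWords X)
    (hD : S.multiplierDiffs ⊆ D) (hT : ∀ w, w ∉ S.langT D) :
    S.langGW D = geodesicWords X := by
  have h1 : 1 ∈ D := hD one_mem_multiplierDiffs
  refine le_antisymm (langGW_le_geodesicWords hS) fun u hu => ?_
  induction u using List.reverseRecOn with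
  | nil => exact nil_mem_langGW hS h1
  | append_singleton u a ih =>
    obtain ⟨v, hv, hlen, heval, hsub⟩ := mem_langGW.1 (ih (mem_geodesicWords_of_append hu))
    have hlen' : (u ++ [a]).length = (v ++ [a]).length := by simp [hlen]
    have heval' : eval (u ++ [a]) = eval (v ++ [a]) := by simp [heval]
    have hva : v ++ [a] ∈ S.langGW D :=
      concat_mem_langGW hS hD hv (mem_geodesicWords_of_eq hu hlen'.symm heval'.symm)
    by_contra hcon
    refine hT _ (mem_langT.2 ⟨hcon, _, hva, hlen', heval', ?_⟩)
    rw [wordDiffs_concat hlen, heval', inv_mul_cancel]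
    exact Set.insert_subset h1 hsub

theorem stronglyGeodesicallyAutomatic_of_forall_notMem_langT (hS : S.W.accepts ≤ geodesicWords X)
    (hfin : D.Finite) (hD : S.multiplierDiffs ⊆ D) (hT : ∀ w, w ∉ S.langT D) :
    StronglyGeodesicallyAutomatic X := by
  have hGW := langGW_eq_geodesicWords hS hD hT
  refine exists_automaticStructure_of_wordDiffs_subset (hGW ▸ S.isRegular_langGW hfin)
    (fun g => (S.exists_rep g).imp fun w hw => ⟨hS hw.1, hw.2⟩)
    ((hfin.mul hfin).mul hfin.inv) fun u hu v hv x huv => ?_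
  obtain ⟨u', hu', -, heu, hdu⟩ := mem_langGW.1 (hGW ▸ hu)
  obtain ⟨v', hv', -, hev, hdv⟩ := mem_langGW.1 (hGW ▸ hv)
  have huv' : wordDiffs u' v' ⊆ D :=
    (wordDiffs_subset_multiplierDiffs hu' hv' (heu ▸ hev ▸ huv)).trans hD
  calc wordDiffs u v ⊆ wordDiffs u v' * wordDiffs v' v := wordDiffs_subset_mul u v' v
    _ ⊆ wordDiffs u u' * wordDiffs u' v' * (wordDiffs v v')⁻¹ := by
      rw [wordDiffs_inv]
      exact Set.mul_subset_mul_right (wordDiffs_subset_mul u u' v')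
    _ ⊆ D * D * D⁻¹ :=
      Set.mul_subset_mul (Set.mul_subset_mul hdu huv') (Set.inv_subset_inv.2 hdv)

variable [LinearOrder (Alphabet X)]

theorem exists_isRun (hS : S.W.accepts ≤ shortLexWords X) : ∃ WD : ℕ → Set G, S.IsRun WD := by
  have hnext (D : Set G) : ∃ D' : Set G,
      ((∃ w, w ∈ S.langT D) → ∃ w ∈ S.langT D, ∃ v ∈ shortLexWords X, eval v = eval w ∧
        D' = D ∪ wordDiffs w v) ∧ ((¬ ∃ w, w ∈ S.langT D) → D' = D) := by
    by_cases h : ∃ w, w ∈ S.langT D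
    · obtain ⟨w, hw⟩ := h
      obtain ⟨v, hv, heval⟩ := S.exists_rep (eval w)
      exact ⟨_, fun _ => ⟨w, hw, v, hS hv, heval, rfl⟩, fun h => (h ⟨w, hw⟩).elim⟩
    · exact ⟨D, fun h' => (h h').elim, fun _ => rfl⟩
  choose next hsucc hhalted using hnext
  exact ⟨fun n => next^[n] S.multiplierDiffs, rfl,
    fun n h => by simpa only [Function.iterate_succ_apply'] using hsucc _ h,
    fun n h => by simpa only [Function.iterate_succ_apply'] using hhalted _ h⟩

namespace IsRun

variable {WD : ℕ → Set G}

theorem subset_succ (h : S.IsRun WD) (n : ℕ) : WD n ⊆ WD (n + 1) := by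
  by_cases hn : ∃ w, w ∈ S.langT (WD n)
  · obtain ⟨w, -, v, -, -, hWD⟩ := h.succ n hn
    exact hWD ▸ Set.subset_union_left
  · exact (h.halted n hn).ge

theorem multiplierDiffs_subset (h : S.IsRun WD) (n : ℕ) : S.multiplierDiffs ⊆ WD n :=
  h.zero ▸ monotone_nat_of_le_succ h.subset_succ (Nat.zero_le n)

theorem finite (h : S.IsRun WD) (hfin : S.multiplierDiffs.Finite) (n : ℕ) : (WD n).Finite := by
  induction n with
  | zero => exact h.zero ▸ hfin
  | succ n ih =>
    by_cases hn : ∃ w, w ∈ S.langT (WD n)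
    · obtain ⟨w, -, v, -, -, hWD⟩ := h.succ n hn
      exact hWD ▸ ih.union (wordDiffs_finite w v)
    · exact (h.halted n hn).symm ▸ ih

theorem ssubset_succ (h : S.IsRun WD) (hS : S.W.accepts = shortLexWords X) {n : ℕ}
    (hn : ∃ w, w ∈ S.langT (WD n)) : WD n ⊂ WD (n + 1) := by
  obtain ⟨w, hw, v, hv, heval, hWD⟩ := h.succ n hn
  refine (h.subset_succ n).ssubset_of_ne fun heq => (mem_langT.1 hw).1 ?_
  have hlen := length_eq_of_mem_geodesicWords
    (langT_le_geodesicWords (hS.trans_le shortLexWords_le_geodesicWords) hw)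
    (shortLexWords_le_geodesicWords hv) heval.symm
  refine mem_langGW.2 ⟨v, hS ▸ hv, hlen, heval.symm, ?_⟩
  rw [heq, hWD]
  exact Set.subset_union_right

theorem subset_multiplierDiffs_union (h : S.IsRun WD) (hS : S.W.accepts ≤ geodesicWords X)
    {S' : AutomaticStructure X} (hS' : S'.W.accepts = geodesicWords X) (n : ℕ) :
    WD n ⊆ S.multiplierDiffs ∪ S'.multiplierDiffs := by
  induction n with
  | zero => exact h.zero ▸ Set.subset_union_left
  | succ n ih =>
    by_cases hn : ∃ w, w ∈ S.langT (WD n)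
    · obtain ⟨w, hw, v, hv, heval, hWD⟩ := h.succ n hn
      rw [hWD]
      exact Set.union_subset ih (Set.subset_union_of_subset_right
        (wordDiffs_subset_multiplierDiffs_of_eq (hS' ▸ langT_le_geodesicWords hS hw)
          (hS' ▸ shortLexWords_le_geodesicWords hv) heval.symm) _)
    · exact (h.halted n hn).symm ▸ ih

theorem halts_of_forall_subset (h : S.IsRun WD) (hS : S.W.accepts = shortLexWords X) {B : Set G}
    (hB : B.Finite) (hWD : ∀ n, WD n ⊆ B) : S.Halts WD := by
  by_contra hcon
  simp only [Halts, not_exists, not_forall, not_not] at hcon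
  have hmono : StrictMono WD := strictMono_nat_of_lt_succ fun n => h.ssubset_succ hS (hcon n)
  exact Set.infinite_range_of_injective hmono.injective
    (hB.finite_subsets.subset (Set.range_subset_iff.2 hWD))

end IsRun

end AutomaticStructure

end GeodAut

/-- For a group with a short-lex automatic structure `S`, the verification procedure can be run;
along every run all the sets of word-differences are finite and all the languages involved are
regular (so that the automata exist at every stage); and every run halts if and only if the group
is strongly geodesically automatic. -/
theorem mainTheorem1 {G : Type*} [Group G] (X : Set G) (hfin : X.Finite)
    (hgen : Subgroup.closure X = ⊤) [LinearOrder (GeodAut.Alphabet X)]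
    (S : GeodAut.AutomaticStructure X) (hS : S.W.accepts = GeodAut.shortLexWords X) :
    (∃ WD : ℕ → Set G, S.IsRun WD) ∧
    ∀ WD : ℕ → Set G, S.IsRun WD →
      (∀ n, (WD n).Finite ∧ (S.langGE (WD n)).IsRegular ∧ (S.langGW (WD n)).IsRegular ∧
        (S.langT (WD n)).IsRegular) ∧
      (S.Halts WD ↔ GeodAut.StronglyGeodesicallyAutomatic X) := by
  have hgeod : S.W.accepts ≤ GeodAut.geodesicWords X :=
    hS.trans_le GeodAut.shortLexWords_le_geodesicWords
  have hM : S.multiplierDiffs.Finite := S.multiplierDiffs_finite hfin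
  refine ⟨GeodAut.AutomaticStructure.exists_isRun hS.le, fun WD hrun => ?_⟩
  have hWD (n : ℕ) : (WD n).Finite := hrun.finite hM n
  refine ⟨fun n => ⟨hWD n, S.isRegular_langGE (hWD n), S.isRegular_langGW (hWD n),
    S.isRegular_langT (hWD n)⟩, ?_, ?_⟩
  · rintro ⟨n, hT⟩
    exact GeodAut.AutomaticStructure.stronglyGeodesicallyAutomatic_of_forall_notMem_langT
      hgeod (hWD n) (hrun.multiplierDiffs_subset n) hT
  · rintro ⟨S', hS'⟩
    exact hrun.halts_of_forall_subset hS (hM.union (S'.multiplierDiffs_finite hfin))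
      (hrun.subset_multiplierDiffs_union hgeod hS')
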